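/- Let $A_0,A_1,B_0,B_1,R,S$ be finite-dimensional non-zero complex Hilbert spaces (with fixed orthonormal bases) such that $\dim R=\dim A_1$ and $\dim S=\dim B_1$. A quantum channel is a completely positive trace-preserving linear map. A channel $\mathcal E$ from operators on $A_0\otimes B_0$ to operators on $A_1\otimes B_1$ is called LOSR if $\mathcal E=\sum_\lambda p_\lambda\,\mathcal E_A^\lambda\otimes\mathcal E_B^\lambda$ (finite sum) with $p_\lambda\ge 0$, $\sum_\lambda p_\lambda=1$ and quantum channels $\mathcal E_A^\lambda$ from $A_0$ to $A_1$ and $\mathcal E_B^\lambda$ from $B_0$ to $B_1$. Fix density matrices $(\rho^x)_{x\in X}$ on $R\otimes A_0$ and $(\sigma^y)_{y\in Y}$ on $S\otimes B_0$, each family being linearly independent and spanning the space of all linear operators on $R\otimes A_0$, respectively $S\otimes B_0$. Let $(\Psi^a)_a$ and $(\Phi^b)_b$ be the projective measurements in generalized Bell bases of $R\otimes A_1$ and $S\otimes B_1$, i.e. $\Psi^a=|\psi_a\rangle\langle\psi_a|$, $\Phi^b=|\varphi_b\rangle\langle\varphi_b|$ for orthonormal bases $(\psi_a)$, $(\varphi_b)$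 consisting of maximally entangled vectors (both reduced states are maximally mixed). For a channel $\mathcal E$ from $A_0\otimes B_0$ to $A_1\otimes B_1$ and measurements (POVMs) $M=(M^a)_a$ on $R\otimes A_1$, $N=(N^b)_b$ on $S\otimes B_1$ put $$p_{\mathcal E,M,N}(ab|xy)=\mathrm{Tr}\big((M^a\otimes N^b)\,(\mathcal E\otimes\mathrm{id}_{RS})[\rho^x\otimes\sigma^y]\big),\qquad p_{\mathcal E}:=p_{\mathcal E,\Psi,\Phi}.$$ For a real linear functional $\gamma(p)=\sum_{ab,xy}\gamma_{ab,xy}\,p(ab|xy)$ put $$\gamma_{\mathrm{loc}}=\max_{\tilde M,\tilde N}\ \sum_{ab,xy}\gamma_{ab,xy}\,\mathrm{Tr}(\tilde M^a\rho^x)\,\mathrm{Tr}(\tilde N^b\sigma^y),$$ where $\tilde M=(\tilde M^a)_a$ and $\tilde N=(\tilde N^b)_b$ range over all POVMs on $R\otimes A_0$ and $S\otimes B_0$. Then: (1) the maximum $\gamma_{\mathrm{loc}}$ exists for every $\gamma$; (2) a quantum channel $\mathcal E$ from $A_0\otimes B_0$ to $A_1\otimes B_1$ is not LOSR if and only if $\gamma(p_{\mathcal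 E})>\gamma_{\mathrm{loc}}$ for some $\gamma$; (3) (measurement-device independence) for every $\gamma$, every LOSR channel $\mathcal E$ and all POVMs $M=(M^a)_a$, $N=(N^b)_b$ on $R\otimes A_1$ and $S\otimes B_1$, one has $\gamma(p_{\mathcal E,M,N})\le\gamma_{\mathrm{loc}}$. -/

import Mathlib

open scoped Matrix Kronecker ComplexOrder

namespace LOSRWitness

/-- A density matrix on `ℂⁿ`: positive semidefinite with unit trace. -/
def IsState {n : Type*} [Fintype n] (ρ : Matrix n n ℂ) : Prop :=
  ρ.PosSemidef ∧ ρ.trace = 1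

/-- A measurement (POVM) on `ℂⁿ` with outcomes in `α`. -/
def IsPOVM {n α : Type*} [DecidableEq n] [Fintype α] (M : α → Matrix n n ℂ) : Prop :=
  (∀ a, (M a).PosSemidef) ∧ ∑ a, M a = 1

/-- The tensor product `Φ ⊗ Ψ` of two linear maps between matrix algebras: the linear map with
`(Φ ⊗ Ψ)(X ⊗ Y) = Φ(X) ⊗ Ψ(Y)` (see `tensorMap_kronecker`), written out on matrix units. -/
noncomputable def tensorMap {n₀ n₁ m₀ m₁ : Type*} [Fintype n₀] [DecidableEq n₀] [Fintype m₀]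
    [DecidableEq m₀] (Φ : Matrix n₀ n₀ ℂ →ₗ[ℂ] Matrix n₁ n₁ ℂ)
    (Ψ : Matrix m₀ m₀ ℂ →ₗ[ℂ] Matrix m₁ m₁ ℂ) :
    Matrix (n₀ × m₀) (n₀ × m₀) ℂ →ₗ[ℂ] Matrix (n₁ × m₁) (n₁ × m₁) ℂ where
  toFun X := ∑ i, ∑ j, ∑ k, ∑ l,
    X (i, k) (j, l) • (Φ (Matrix.single i j 1) ⊗ₖ Ψ (Matrix.single k l 1))
  map_add' X Y := by simp only [Matrix.add_apply, add_smul, Finset.sum_add_distrib]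
  map_smul' c X := by
    simp only [Matrix.smul_apply, smul_assoc, Finset.smul_sum, RingHom.id_apply]

theorem tensorMap_kronecker {n₀ n₁ m₀ m₁ : Type*} [Fintype n₀] [DecidableEq n₀] [Fintype m₀]
    [DecidableEq m₀] (Φ : Matrix n₀ n₀ ℂ →ₗ[ℂ] Matrix n₁ n₁ ℂ)
    (Ψ : Matrix m₀ m₀ ℂ →ₗ[ℂ] Matrix m₁ m₁ ℂ) (X : Matrix n₀ n₀ ℂ) (Y : Matrix m₀ m₀ ℂ) :
    tensorMap Φ Ψ (X ⊗ₖ Y) = Φ X ⊗ₖ Ψ Y := by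
  have hX : Φ X = ∑ i, ∑ j, X i j • Φ (Matrix.single i j 1) := by
    conv_lhs => rw [Matrix.matrix_eq_sum_single X]
    simp only [map_sum, ← map_smul, Matrix.smul_single, smul_eq_mul, mul_one]
  have hY : Ψ Y = ∑ k, ∑ l, Y k l • Ψ (Matrix.single k l 1) := by
    conv_lhs => rw [Matrix.matrix_eq_sum_single Y]
    simp only [map_sum, ← map_smul, Matrix.smul_single, smul_eq_mul, mul_one]
  ext p q
  rw [hX, hY]
  simp only [tensorMap, LinearMap.coe_mk, AddHom.coe_mk, Matrix.sum_apply, Matrix.smul_apply,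
    Matrix.kroneckerMap_apply, smul_eq_mul]
  rw [Finset.sum_mul]
  refine Finset.sum_congr rfl fun i _ => ?_
  rw [Finset.sum_mul]
  refine Finset.sum_congr rfl fun j _ => ?_
  rw [Finset.mul_sum]
  refine Finset.sum_congr rfl fun k _ => ?_
  rw [Finset.mul_sum]
  refine Finset.sum_congr rfl fun l _ => ?_
  ring

/-- Complete positivity: `id_k ⊗ Φ` maps positive semidefinite matrices to positive semidefinite
matrices, for every ancilla dimension `k`. -/
def IsCompletelyPositive {n m : Type*} [Fintype n] [DecidableEq n]
    (Φ : Matrix n n ℂ →ₗ[ℂ] Matrix m m ℂ) : Prop :=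
  ∀ (k : ℕ) (X : Matrix (Fin k × n) (Fin k × n) ℂ), X.PosSemidef →
    (tensorMap (LinearMap.id : Matrix (Fin k) (Fin k) ℂ →ₗ[ℂ] Matrix (Fin k) (Fin k) ℂ)
      Φ X).PosSemidef

/-- A quantum channel: a completely positive, trace preserving linear map. -/
def IsChannel {n m : Type*} [Fintype n] [DecidableEq n] [Fintype m]
    (Φ : Matrix n n ℂ →ₗ[ℂ] Matrix m m ℂ) : Prop :=
  IsCompletelyPositive Φ ∧ ∀ X, (Φ X).trace = X.trace

/-- Local operations assisted by shared randomness: convex combinations of tensor products of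
quantum channels. -/
def IsLOSR {A₀ A₁ B₀ B₁ : Type*} [Fintype A₀] [DecidableEq A₀] [Fintype A₁]
    [Fintype B₀] [DecidableEq B₀] [Fintype B₁]
    (E : Matrix (A₀ × B₀) (A₀ × B₀) ℂ →ₗ[ℂ] Matrix (A₁ × B₁) (A₁ × B₁) ℂ) : Prop :=
  ∃ (n : ℕ) (p : Fin n → ℝ) (EA : Fin n → (Matrix A₀ A₀ ℂ →ₗ[ℂ] Matrix A₁ A₁ ℂ))
    (EB : Fin n → (Matrix B₀ B₀ ℂ →ₗ[ℂ] Matrix B₁ B₁ ℂ)),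
    (∀ i, 0 ≤ p i) ∧ ∑ i, p i = 1 ∧ (∀ i, IsChannel (EA i)) ∧ (∀ i, IsChannel (EB i)) ∧
      E = ∑ i, (p i : ℂ) • tensorMap (EA i) (EB i)

/-- Reordering of tensor factors, `RA ⊗ SB ≃ AB ⊗ RS`. -/
def shuffle (R A S B : Type*) : (R × A) × (S × B) ≃ (A × B) × (R × S) where
  toFun t := ((t.1.2, t.2.2), (t.1.1, t.2.1))
  invFun t := ((t.2.1, t.1.1), (t.2.2, t.1.2))
  left_inv _ := rfl
  right_inv _ := rfl

/-- The map `E_{AB} ⊗ id_{RS}`, acting on matrices over the ordering `RA₀ ⊗ SB₀` of the input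
factors and returning matrices over the ordering `RA₁ ⊗ SB₁` of the output factors. -/
noncomputable def extend {A₀ A₁ B₀ B₁ : Type*} (R S : Type*) [Fintype A₀] [DecidableEq A₀]
    [Fintype B₀] [DecidableEq B₀] [Fintype R] [DecidableEq R] [Fintype S] [DecidableEq S]
    (E : Matrix (A₀ × B₀) (A₀ × B₀) ℂ →ₗ[ℂ] Matrix (A₁ × B₁) (A₁ × B₁) ℂ)
    (X : Matrix ((R × A₀) × (S × B₀)) ((R × A₀) × (S × B₀)) ℂ) :
    Matrix ((R × A₁) × (S × B₁)) ((R × A₁) × (S × B₁)) ℂ :=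
  Matrix.reindex (shuffle R A₁ S B₁).symm (shuffle R A₁ S B₁).symm
    (tensorMap E (LinearMap.id : Matrix (R × S) (R × S) ℂ →ₗ[ℂ] Matrix (R × S) (R × S) ℂ)
      (Matrix.reindex (shuffle R A₀ S B₀) (shuffle R A₀ S B₀) X))

/-- The distribution `p(a,b|x,y) = Tr((Mᵃ ⊗ Nᵇ) (E_{AB} ⊗ id_{RS})[ρˣ ⊗ σʸ])`. -/
noncomputable def behaviour {A₀ A₁ B₀ B₁ R S X Y α β : Type*} [Fintype A₀] [DecidableEq A₀]
    [Fintype A₁] [Fintype B₀] [DecidableEq B₀] [Fintype B₁] [Fintype R] [DecidableEq R]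
    [Fintype S] [DecidableEq S]
    (E : Matrix (A₀ × B₀) (A₀ × B₀) ℂ →ₗ[ℂ] Matrix (A₁ × B₁) (A₁ × B₁) ℂ)
    (ρ : X → Matrix (R × A₀) (R × A₀) ℂ) (σ : Y → Matrix (S × B₀) (S × B₀) ℂ)
    (M : α → Matrix (R × A₁) (R × A₁) ℂ) (N : β → Matrix (S × B₁) (S × B₁) ℂ)
    (a : α) (b : β) (x : X) (y : Y) : ℝ :=
  (((M a ⊗ₖ N b) * extend R S E (ρ x ⊗ₖ σ y)).trace).re

/-- The value `γ(p) = ∑ γ_{ab,xy} p(ab|xy)` of the linear functional with coefficients `γ`. -/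
def value {X Y α β : Type*} [Fintype X] [Fintype Y] [Fintype α] [Fintype β]
    (γ p : α → β → X → Y → ℝ) : ℝ :=
  ∑ a, ∑ b, ∑ x, ∑ y, γ a b x y * p a b x y

/-- All values `∑ γ_{ab,xy} Tr(Mᵃ ρˣ) Tr(Nᵇ σʸ)`, for measurements `M`, `N` on the two input
spaces. -/
def localValues {m n X Y α β : Type*} [Fintype m] [DecidableEq m] [Fintype n] [DecidableEq n]
    [Fintype X] [Fintype Y] [Fintype α] [Fintype β]
    (ρ : X → Matrix m m ℂ) (σ : Y → Matrix n n ℂ) (γ : α → β → X → Y → ℝ) : Set ℝ :=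
  {v | ∃ (M : α → Matrix m m ℂ) (N : β → Matrix n n ℂ), IsPOVM M ∧ IsPOVM N ∧
    v = value γ fun a b x y => ((M a * ρ x).trace).re * ((N b * σ y).trace).re}

/-- The supremum of `localValues`; that it is an attained maximum is part of the theorem. -/
noncomputable def localMax {m n X Y α β : Type*} [Fintype m] [DecidableEq m] [Fintype n]
    [DecidableEq n] [Fintype X] [Fintype Y] [Fintype α] [Fintype β]
    (ρ : X → Matrix m m ℂ) (σ : Y → Matrix n n ℂ) (γ : α → β → X → Y → ℝ) : ℝ :=
  sSup (localValues ρ σ γ)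

/-- The rank-one matrix `|ψ⟩⟨ψ|`. -/
def ketbra {n : Type*} (ψ : EuclideanSpace ℂ n) : Matrix n n ℂ :=
  Matrix.of fun i j => ψ i * star (ψ j)

/-- Partial trace over the first factor. -/
def traceFst {m n : Type*} [Fintype m] (X : Matrix (m × n) (m × n) ℂ) : Matrix n n ℂ :=
  Matrix.of fun i j => ∑ r, X (r, i) (r, j)

/-- Partial trace over the second factor. -/
def traceSnd {m n : Type*} [Fintype n] (X : Matrix (m × n) (m × n) ℂ) : Matrix m m ℂ :=
  Matrix.of fun r s => ∑ i, X (r, i) (s, i)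

/-- A generalized Bell basis of `ℂᴿ ⊗ ℂᴬ`: an orthonormal basis all of whose members are maximally
entangled, that is, both reduced states of each member are maximally mixed. Such a basis exists
only if the two factors have the same dimension `d`. An example, for `d` given, is
`φ_{ab} = d^{-1/2} ∑ₖ exp(2πi b k / d) |k, k + a⟩`. -/
def IsBellBasis {R A α : Type*} [Fintype R] [DecidableEq R] [Fintype A] [DecidableEq A]
    [Fintype α] (ψ : OrthonormalBasis α ℂ (EuclideanSpace ℂ (R × A))) : Prop :=
  ∀ a, traceFst (ketbra (ψ a)) = (1 / (Fintype.card A : ℂ)) • (1 : Matrix A A ℂ) ∧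
    traceSnd (ketbra (ψ a)) = (1 / (Fintype.card R : ℂ)) • (1 : Matrix R R ℂ)

/-- The projective measurement in an orthonormal basis. -/
noncomputable def basisMeasurement {n α : Type*} [Fintype n] [Fintype α]
    (ψ : OrthonormalBasis α ℂ (EuclideanSpace ℂ n)) (a : α) : Matrix n n ℂ :=
  ketbra (ψ a)

end LOSRWitness

/-! The easy direction is trace duality. Pulling a measurement on the output back through a local
channel gives a measurement on the input, so the correlations of an LOSR channel are a convex
mixture of products `Tr(M ρ) Tr(N σ)`, whatever measurements follow (`value_behaviour_le_localMax`).

For the converse, the POVMs form a compact set, so the convex hull of the product correlations is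
compact. By Hahn–Banach, correlations that obey every local bound lie in that hull
(`exists_convex_localCorrelation`). The resulting decomposition holds for all input operators,
because the states span (`trace_eq_of_span`).

Teleportation then gives back the channel. Let `w_l` be the columns of a Bell vector `ψ_a`. The
input `|w_l⟩⟨w_k| ⊗ T` followed by outcome `a` exposes the `(l, k)` entry of the output, with the
same factor for every `a` (`trace_bell_mul_extend`). Inserting such inputs into each product term
and summing over outcomes turns its two measurements into two channels (`isChannel_recoveredMap`),
so the decomposition of the correlations becomes an LOSR decomposition of the channel
(`isLOSR_of_value_le_localMax`). -/

namespace LOSRWitness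

/-! ### Positivity, tensor extensions and trace duality -/

section General

variable {n m κ : Type*}

theorem exists_conjTranspose_mul_self [Fintype n] {M : Matrix n n ℂ} (hM : M.PosSemidef) :
    ∃ B : Matrix n n ℂ, M = Bᴴ * B := by
  classical
  open scoped MatrixOrder in
  open Matrix.Norms.L2Operator in
  exact CStarAlgebra.nonneg_iff_eq_star_mul_self.mp hM.nonneg

theorem trace_mul_nonneg [Fintype n] {M N : Matrix n n ℂ} (hM : M.PosSemidef)
    (hN : N.PosSemidef) : 0 ≤ (M * N).trace := by
  obtain ⟨B, rfl⟩ := exists_conjTranspose_mul_self hM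
  rw [Matrix.mul_assoc, Matrix.trace_mul_comm]
  exact (hN.mul_mul_conjTranspose_same B).trace_nonneg

theorem ofReal_re_of_nonneg {z : ℂ} (hz : 0 ≤ z) : ((z.re : ℝ) : ℂ) = z :=
  (Complex.eq_re_of_ofReal_le (r := 0) (by simpa using hz)).symm

/-- The sesquilinear form of a matrix as a trace against a rank-one matrix. -/
theorem trace_mul_vecMulVec_star [Fintype n] (M : Matrix n n ℂ) (v : n → ℂ) :
    (M * Matrix.vecMulVec v (star v)).trace = star v ⬝ᵥ (M *ᵥ v) := by
  rw [Matrix.mul_vecMulVec, Matrix.trace_vecMulVec, dotProduct_comm]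

/-- Self-duality of the positive cone. Rank-one tests already suffice, and over `ℂ` a real
nonnegative quadratic form forces hermiticity. -/
theorem posSemidef_of_trace_nonneg [Fintype n] {M : Matrix n n ℂ}
    (h : ∀ X : Matrix n n ℂ, X.PosSemidef → 0 ≤ (M * X).trace) : M.PosSemidef := by
  classical
  have h' : ∀ v : n → ℂ, 0 ≤ star v ⬝ᵥ (M *ᵥ v) := fun v => by
    rw [← trace_mul_vecMulVec_star]
    exact h _ (Matrix.posSemidef_vecMulVec_self_star v)
  rw [← Matrix.isPositive_toEuclideanLin_iff, LinearMap.isPositive_iff_complex]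
  intro v
  have hv : 0 ≤ inner ℂ (M.toEuclideanLin v) v := by
    rw [← inner_conj_symm, EuclideanSpace.inner_eq_star_dotProduct, dotProduct_comm]
    exact star_nonneg_iff.2 (h' v.ofLp)
  exact ⟨ofReal_re_of_nonneg hv, (Complex.le_def.1 hv).1⟩

theorem linearMap_ext_kronecker [Finite n] [Finite m] {V : Type*} [AddCommMonoid V] [Module ℂ V]
    {f g : Matrix (n × m) (n × m) ℂ →ₗ[ℂ] V}
    (h : ∀ (X : Matrix n n ℂ) (Y : Matrix m m ℂ), f (X ⊗ₖ Y) = g (X ⊗ₖ Y)) : f = g := by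
  classical
  cases nonempty_fintype n
  cases nonempty_fintype m
  refine Matrix.ext_linearMap _ fun i j => LinearMap.ext_ring ?_
  have := h (Matrix.single i.1 j.1 1) (Matrix.single i.2 j.2 1)
  rw [Matrix.single_kronecker_single] at this
  simpa using this

variable [Fintype n] [DecidableEq n]

theorem map_eq_sum_single (Φ : Matrix n n ℂ →ₗ[ℂ] Matrix m m ℂ) (Z : Matrix n n ℂ) (i j : m) :
    Φ Z i j = ∑ k, ∑ l, Z k l * Φ (Matrix.single k l 1) i j := by
  conv_lhs => rw [Matrix.matrix_eq_sum_single Z]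
  have h : ∀ k l, Φ (Matrix.single k l (Z k l)) = Z k l • Φ (Matrix.single k l 1) := fun k l => by
    rw [← map_smul, Matrix.smul_single, smul_eq_mul, mul_one]
  simp only [map_sum, h, Matrix.sum_apply, Matrix.smul_apply, smul_eq_mul]

theorem tensorMap_id_left_apply [Fintype κ] [DecidableEq κ]
    (Φ : Matrix n n ℂ →ₗ[ℂ] Matrix m m ℂ) (X : Matrix (κ × n) (κ × n) ℂ) (p q : κ × m) :
    tensorMap (LinearMap.id : Matrix κ κ ℂ →ₗ[ℂ] Matrix κ κ ℂ) Φ X p q =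
      Φ (X.submatrix (Prod.mk p.1) (Prod.mk q.1)) p.2 q.2 := by
  rw [map_eq_sum_single Φ]
  simp only [tensorMap, LinearMap.coe_mk, AddHom.coe_mk, Matrix.sum_apply, Matrix.smul_apply,
    Matrix.kroneckerMap_apply, smul_eq_mul, LinearMap.id_apply, Matrix.submatrix_apply]
  rw [Finset.sum_eq_single p.1, Finset.sum_eq_single q.1]
  · simp
  · intro j _ hj; simp [hj]
  · simp
  · intro i _ hi; simp [hi]
  · simp

theorem tensorMap_id_right_apply [Fintype κ] [DecidableEq κ]
    (Φ : Matrix n n ℂ →ₗ[ℂ] Matrix m m ℂ) (X : Matrix (n × κ) (n × κ) ℂ) (p q : m × κ) :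
    tensorMap Φ (LinearMap.id : Matrix κ κ ℂ →ₗ[ℂ] Matrix κ κ ℂ) X p q =
      Φ (X.submatrix (fun i => (i, p.2)) (fun i => (i, q.2))) p.1 q.1 := by
  rw [map_eq_sum_single Φ]
  simp only [tensorMap, LinearMap.coe_mk, AddHom.coe_mk, Matrix.sum_apply, Matrix.smul_apply,
    Matrix.kroneckerMap_apply, smul_eq_mul, LinearMap.id_apply, Matrix.submatrix_apply]
  refine Finset.sum_congr rfl fun i _ => Finset.sum_congr rfl fun j _ => ?_
  rw [Finset.sum_eq_single p.2, Finset.sum_eq_single q.2]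
  · simp
  · intro j _ hj; simp [hj]
  · simp
  · intro i _ hi; simp [hi]
  · simp

/-- Relabelling the ancilla passes from the `Fin k` of the definition to any finite index type,
since the map acts blockwise. -/
theorem IsCompletelyPositive.tensorMap_id_left [Fintype κ] [DecidableEq κ]
    {Φ : Matrix n n ℂ →ₗ[ℂ] Matrix m m ℂ} (hΦ : IsCompletelyPositive Φ)
    {X : Matrix (κ × n) (κ × n) ℂ} (hX : X.PosSemidef) :
    (tensorMap (LinearMap.id : Matrix κ κ ℂ →ₗ[ℂ] Matrix κ κ ℂ) Φ X).PosSemidef := by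
  have e := Fintype.equivFin κ
  convert (hΦ _ _ (hX.submatrix (Prod.map e.symm id))).submatrix (Prod.map e id) using 1
  ext p q
  simp only [tensorMap_id_left_apply, Matrix.submatrix_apply, Prod.map_fst, Prod.map_snd, id,
    Matrix.submatrix_submatrix]
  simp [Function.comp_def]

theorem IsCompletelyPositive.tensorMap_id_right [Fintype κ] [DecidableEq κ]
    {Φ : Matrix n n ℂ →ₗ[ℂ] Matrix m m ℂ} (hΦ : IsCompletelyPositive Φ)
    {X : Matrix (n × κ) (n × κ) ℂ} (hX : X.PosSemidef) :
    (tensorMap Φ (LinearMap.id : Matrix κ κ ℂ →ₗ[ℂ] Matrix κ κ ℂ) X).PosSemidef := by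
  convert (hΦ.tensorMap_id_left (hX.submatrix Prod.swap)).submatrix Prod.swap using 1
  ext p q
  simp only [tensorMap_id_left_apply, tensorMap_id_right_apply, Matrix.submatrix_apply,
    Matrix.submatrix_submatrix]
  rfl

/-- A map with a Kraus decomposition is completely positive. -/
theorem isCompletelyPositive_of_kraus {ι : Type*} [Fintype ι]
    [Fintype m] {Φ : Matrix n n ℂ →ₗ[ℂ] Matrix m m ℂ} (K : ι → Matrix m n ℂ)
    (hΦ : ∀ T, Φ T = ∑ c, K c * T * (K c)ᴴ) : IsCompletelyPositive Φ := by
  intro k X hX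
  have h : tensorMap (LinearMap.id : Matrix (Fin k) (Fin k) ℂ →ₗ[ℂ] Matrix (Fin k) (Fin k) ℂ) Φ X =
      ∑ c, ((1 : Matrix (Fin k) (Fin k) ℂ) ⊗ₖ K c) * X *
        ((1 : Matrix (Fin k) (Fin k) ℂ) ⊗ₖ K c)ᴴ := by
    let g : Matrix (Fin k × n) (Fin k × n) ℂ →ₗ[ℂ] Matrix (Fin k × m) (Fin k × m) ℂ :=
      { toFun := fun X => ∑ c, ((1 : Matrix (Fin k) (Fin k) ℂ) ⊗ₖ K c) * X *
          ((1 : Matrix (Fin k) (Fin k) ℂ) ⊗ₖ K c)ᴴ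
        map_add' := fun X Y => by simp only [Matrix.mul_add, Matrix.add_mul, Finset.sum_add_distrib]
        map_smul' := fun c X => by simp [Finset.smul_sum] }
    have : tensorMap LinearMap.id Φ = g := by
      refine linearMap_ext_kronecker fun Y Z => ?_
      rw [tensorMap_kronecker, hΦ]
      simp only [g, LinearMap.coe_mk, AddHom.coe_mk, Matrix.conjTranspose_kronecker,
        ← Matrix.mul_kronecker_mul, Matrix.conjTranspose_one, Matrix.one_mul, Matrix.mul_one]
      ext p q
      simp [Matrix.sum_apply, Finset.mul_sum]
    exact LinearMap.congr_fun this X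
  rw [h]
  exact Matrix.posSemidef_sum _ fun c _ => hX.mul_mul_conjTranspose_same _

/-- The dual of a linear map of matrix algebras with respect to the trace pairing. -/
noncomputable def traceDual [Fintype m] (L : Matrix n n ℂ →ₗ[ℂ] Matrix m m ℂ)
    (M : Matrix m m ℂ) : Matrix n n ℂ :=
  Matrix.of fun i j => (M * L (Matrix.single j i 1)).trace

theorem trace_traceDual_mul [Fintype m] (L : Matrix n n ℂ →ₗ[ℂ] Matrix m m ℂ)
    (M : Matrix m m ℂ) (X : Matrix n n ℂ) :
    (traceDual L M * X).trace = (M * L X).trace := by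
  let f : Matrix n n ℂ →ₗ[ℂ] ℂ := Matrix.traceLinearMap n ℂ ℂ ∘ₗ LinearMap.mulLeft ℂ (traceDual L M)
  let g : Matrix n n ℂ →ₗ[ℂ] ℂ := Matrix.traceLinearMap m ℂ ℂ ∘ₗ LinearMap.mulLeft ℂ M ∘ₗ L
  have : f = g := by
    refine Matrix.ext_linearMap _ fun i j => LinearMap.ext_ring ?_
    simp [f, g, Matrix.trace_mul_single, traceDual]
  exact LinearMap.congr_fun this X

end General

/-! ### Measurements: duality and compactness -/

section Measurements

variable {n m α R : Type*}

/-- The dual of a positive map is positive, and the dual of a trace-preserving map is unital. -/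
theorem IsPOVM.traceDual [Fintype n] [DecidableEq n] [Fintype m] [DecidableEq m] [Fintype α]
    {L : Matrix n n ℂ →ₗ[ℂ] Matrix m m ℂ} (hpos : ∀ X, X.PosSemidef → (L X).PosSemidef)
    (htr : ∀ X, (L X).trace = X.trace) {M : α → Matrix m m ℂ} (hM : IsPOVM M) :
    IsPOVM fun a => traceDual L (M a) := by
  refine ⟨fun a => posSemidef_of_trace_nonneg fun X hX => ?_, ?_⟩
  · rw [trace_traceDual_mul]
    exact trace_mul_nonneg (hM.1 a) (hpos X hX)
  · refine Matrix.ext_iff_trace_mul_right.2 fun X => ?_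
    simp only [Finset.sum_mul, Matrix.trace_sum, trace_traceDual_mul]
    rw [← Matrix.trace_sum, ← Finset.sum_mul, hM.2, one_mul, one_mul, htr]

theorem trace_tensorMap_id_left [Fintype n] [DecidableEq n] [Fintype m] [Fintype R]
    [DecidableEq R] {Φ : Matrix n n ℂ →ₗ[ℂ] Matrix m m ℂ} (hΦ : ∀ X, (Φ X).trace = X.trace)
    (X : Matrix (R × n) (R × n) ℂ) :
    (tensorMap (LinearMap.id : Matrix R R ℂ →ₗ[ℂ] Matrix R R ℂ) Φ X).trace = X.trace := by
  simp only [Matrix.trace, Matrix.diag_apply, Fintype.sum_prod_type, tensorMap_id_left_apply]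
  exact Finset.sum_congr rfl fun r _ => hΦ (X.submatrix (Prod.mk r) (Prod.mk r))

/-- Applying a channel to one half of a system before a measurement is again a measurement. -/
theorem IsPOVM.pullback [Fintype n] [DecidableEq n] [Fintype m] [DecidableEq m] [Fintype R]
    [DecidableEq R] [Fintype α] {Φ : Matrix n n ℂ →ₗ[ℂ] Matrix m m ℂ} (hΦ : IsChannel Φ)
    {M : α → Matrix (R × m) (R × m) ℂ} (hM : IsPOVM M) :
    IsPOVM fun a => LOSRWitness.traceDual (tensorMap LinearMap.id Φ) (M a) :=
  hM.traceDual (fun _ => hΦ.1.tensorMap_id_left) (trace_tensorMap_id_left hΦ.2)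

theorem ketbra_eq_vecMulVec (v : EuclideanSpace ℂ n) :
    ketbra v = Matrix.vecMulVec v.ofLp (star v.ofLp) := rfl

theorem isPOVM_basisMeasurement [Fintype n] [DecidableEq n] [Fintype α]
    (ψ : OrthonormalBasis α ℂ (EuclideanSpace ℂ n)) : IsPOVM (basisMeasurement ψ) := by
  refine ⟨fun a => Matrix.posSemidef_vecMulVec_self_star _, ?_⟩
  ext i j
  have h := ψ.sum_inner_mul_inner (EuclideanSpace.single i (1 : ℂ)) (EuclideanSpace.single j 1)
  simpa [basisMeasurement, ketbra, Matrix.sum_apply, EuclideanSpace.inner_single_left,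
    EuclideanSpace.inner_single_right, Matrix.one_apply, eq_comm, PiLp.single_apply] using h

/-- Diagonal entries lie in `[0, 1]`, being nonnegative terms of a sum equal to 1. The `2 × 2`
principal minors then give `|M_ij|² ≤ M_ii M_jj ≤ 1`. This is the boundedness half of compactness.
-/
theorem norm_apply_le_one_of_isPOVM [Fintype n] [DecidableEq n] [Fintype α]
    {M : α → Matrix n n ℂ} (hM : IsPOVM M) (a : α) (i j : n) : ‖M a i j‖ ≤ 1 := by
  have hd : ∀ i, 0 ≤ (M a i i).re ∧ (M a i i).re ≤ 1 ∧ (M a i i).im = 0 := fun i => by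
    have h0 : ∀ b, 0 ≤ M b i i := fun b => (hM.1 b).diag_nonneg
    have h1 : ∑ b, M b i i = 1 := by
      have := congrFun (congrFun hM.2 i) i
      simpa [Matrix.sum_apply] using this
    have h2 : M a i i ≤ 1 := h1 ▸ Finset.single_le_sum (fun b _ => h0 b) (Finset.mem_univ a)
    exact ⟨(Complex.le_def.1 (h0 a)).1, (Complex.le_def.1 h2).1, ((Complex.le_def.1 (h0 a)).2).symm⟩
  have hdet := ((hM.1 a).submatrix ![i, j]).det_nonneg
  rw [Matrix.det_fin_two] at hdet
  have hji : M a j i = star (M a i j) := by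
    conv_lhs => rw [← (hM.1 a).1]
    rfl
  simp only [Matrix.submatrix_apply, Matrix.cons_val_zero, Matrix.cons_val_one, hji] at hdet
  have h := (Complex.le_def.1 hdet).1
  rw [Complex.star_def, Complex.mul_conj, Complex.normSq_eq_norm_sq] at h
  simp only [Complex.sub_re, Complex.mul_re, Complex.zero_re, (hd i).2.2, (hd j).2.2,
    Complex.ofReal_re] at h
  have h1 := mul_le_one₀ (hd i).2.1 (hd j).1 (hd j).2.1
  nlinarith [norm_nonneg (M a i j)]

theorem isClosed_posSemidef [Fintype n] : IsClosed {M : Matrix n n ℂ | M.PosSemidef} := by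
  simp only [Matrix.posSemidef_iff_dotProduct_mulVec, Matrix.IsHermitian, Set.ofPred_and,
    Set.ofPred_forall]
  refine (isClosed_eq (by fun_prop) (by fun_prop)).inter (isClosed_iInter fun v => ?_)
  exact isClosed_le (by fun_prop) (by fun_prop)

theorem isCompact_isPOVM [Fintype n] [DecidableEq n] [Fintype α] :
    IsCompact {M : α → Matrix n n ℂ | IsPOVM M} := by
  have hc : IsCompact (Set.univ.pi fun _ : α => (Set.univ.pi fun _ : n => Set.univ.pi fun _ : n =>
      Metric.closedBall (0 : ℂ) 1 : Set (Matrix n n ℂ))) :=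
    isCompact_univ_pi fun _ => isCompact_univ_pi fun _ => isCompact_univ_pi fun _ =>
      isCompact_closedBall 0 1
  refine hc.of_isClosed_subset ?_ fun M hM => ?_
  · simp only [IsPOVM, Set.ofPred_and, Set.ofPred_forall]
    refine (isClosed_iInter fun a => ?_).inter (isClosed_eq (by fun_prop) (by fun_prop))
    exact (isClosed_posSemidef (n := n)).preimage (f := fun M : α → Matrix n n ℂ => M a)
      (continuous_apply a)
  · simpa [Set.mem_pi] using fun a i j => norm_apply_le_one_of_isPOVM hM a i j

theorem exists_isPOVM [DecidableEq n] [Fintype n] [Fintype α] [Nonempty α] :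
    ∃ M : α → Matrix n n ℂ, IsPOVM M := by
  classical
  inhabit α
  refine ⟨Pi.single default 1, fun a => ?_, by simp⟩
  by_cases h : a = default
  · subst h; simpa using Matrix.PosSemidef.one
  · simpa [h] using Matrix.PosSemidef.zero

end Measurements

/-! ### Extending bipartite maps by the identity on the reference systems -/

section Extension

variable {A₀ A₁ B₀ B₁ R S : Type*} [Fintype A₀] [DecidableEq A₀]
    [Fintype B₀] [DecidableEq B₀] [Fintype R] [DecidableEq R] [Fintype S] [DecidableEq S]

/-- `extend` as a linear map. -/
noncomputable def extendLin (R S : Type*) [Fintype R] [DecidableEq R] [Fintype S] [DecidableEq S]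
    (E : Matrix (A₀ × B₀) (A₀ × B₀) ℂ →ₗ[ℂ] Matrix (A₁ × B₁) (A₁ × B₁) ℂ) :
    Matrix ((R × A₀) × (S × B₀)) ((R × A₀) × (S × B₀)) ℂ →ₗ[ℂ]
      Matrix ((R × A₁) × (S × B₁)) ((R × A₁) × (S × B₁)) ℂ :=
  (Matrix.reindexLinearEquiv ℂ ℂ (shuffle R A₁ S B₁).symm (shuffle R A₁ S B₁).symm).toLinearMap ∘ₗ
    tensorMap E LinearMap.id ∘ₗ
    (Matrix.reindexLinearEquiv ℂ ℂ (shuffle R A₀ S B₀) (shuffle R A₀ S B₀)).toLinearMap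

theorem extend_kronecker
    (E : Matrix (A₀ × B₀) (A₀ × B₀) ℂ →ₗ[ℂ] Matrix (A₁ × B₁) (A₁ × B₁) ℂ)
    (G : Matrix R R ℂ) (T : Matrix A₀ A₀ ℂ) (H : Matrix S S ℂ) (Q : Matrix B₀ B₀ ℂ) :
    extend R S E ((G ⊗ₖ T) ⊗ₖ (H ⊗ₖ Q)) =
      Matrix.reindex (shuffle R A₁ S B₁).symm (shuffle R A₁ S B₁).symm
        (E (T ⊗ₖ Q) ⊗ₖ (G ⊗ₖ H)) := by
  have h : Matrix.reindex (shuffle R A₀ S B₀) (shuffle R A₀ S B₀) ((G ⊗ₖ T) ⊗ₖ (H ⊗ₖ Q)) =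
      (T ⊗ₖ Q) ⊗ₖ (G ⊗ₖ H) := by
    ext p q
    simp only [shuffle, Matrix.reindex_apply, Matrix.submatrix_apply, Matrix.kroneckerMap_apply,
      Equiv.coe_fn_symm_mk]
    ring
  rw [extend, h, tensorMap_kronecker, LinearMap.id_apply]

theorem reindex_shuffle_kronecker {R S : Type*} (G : Matrix R R ℂ) (T : Matrix A₁ A₁ ℂ) (H : Matrix S S ℂ)
    (Q : Matrix B₁ B₁ ℂ) :
    Matrix.reindex (shuffle R A₁ S B₁).symm (shuffle R A₁ S B₁).symm ((T ⊗ₖ Q) ⊗ₖ (G ⊗ₖ H)) =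
      (G ⊗ₖ T) ⊗ₖ (H ⊗ₖ Q) := by
  ext p q
  simp only [shuffle, Matrix.reindex_apply, Matrix.submatrix_apply, Matrix.kroneckerMap_apply,
    Equiv.symm_symm, Equiv.coe_fn_mk]
  ring

/-- Both sides are bilinear in `X` and `Y`, so it suffices to compare them on fourfold elementary
tensors, where only the order of the factors matters. -/
theorem extend_tensorMap (F : Matrix A₀ A₀ ℂ →ₗ[ℂ] Matrix A₁ A₁ ℂ)
    (F' : Matrix B₀ B₀ ℂ →ₗ[ℂ] Matrix B₁ B₁ ℂ) (X : Matrix (R × A₀) (R × A₀) ℂ)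
    (Y : Matrix (S × B₀) (S × B₀) ℂ) :
    extend R S (tensorMap F F') (X ⊗ₖ Y) =
      tensorMap (LinearMap.id : Matrix R R ℂ →ₗ[ℂ] Matrix R R ℂ) F X ⊗ₖ
        tensorMap (LinearMap.id : Matrix S S ℂ →ₗ[ℂ] Matrix S S ℂ) F' Y := by
  have h : (Matrix.kroneckerBilinear (R := ℂ) (α := ℂ)).compr₂ (extendLin R S (tensorMap F F')) =
      (Matrix.kroneckerBilinear (R := ℂ) (α := ℂ)).compl₁₂
        (tensorMap (LinearMap.id : Matrix R R ℂ →ₗ[ℂ] Matrix R R ℂ) F)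
        (tensorMap (LinearMap.id : Matrix S S ℂ →ₗ[ℂ] Matrix S S ℂ) F') := by
    refine linearMap_ext_kronecker fun G T => linearMap_ext_kronecker fun H Q => ?_
    change extend R S (tensorMap F F') ((G ⊗ₖ T) ⊗ₖ (H ⊗ₖ Q)) =
      tensorMap LinearMap.id F (G ⊗ₖ T) ⊗ₖ tensorMap LinearMap.id F' (H ⊗ₖ Q)
    rw [extend_kronecker, tensorMap_kronecker, tensorMap_kronecker, tensorMap_kronecker,
      reindex_shuffle_kronecker, LinearMap.id_apply, LinearMap.id_apply]
  exact LinearMap.congr_fun (LinearMap.congr_fun h X) Y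

theorem extend_posSemidef
    {E : Matrix (A₀ × B₀) (A₀ × B₀) ℂ →ₗ[ℂ] Matrix (A₁ × B₁) (A₁ × B₁) ℂ}
    (hE : IsCompletelyPositive E)
    {X : Matrix ((R × A₀) × (S × B₀)) ((R × A₀) × (S × B₀)) ℂ} (hX : X.PosSemidef) :
    (extend R S E X).PosSemidef :=
  (hE.tensorMap_id_right (hX.submatrix _)).submatrix _

theorem extend_sum_smul {ι : Type*} [Fintype ι] (c : ι → ℂ)
    (F : ι → (Matrix (A₀ × B₀) (A₀ × B₀) ℂ →ₗ[ℂ] Matrix (A₁ × B₁) (A₁ × B₁) ℂ))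
    (X : Matrix ((R × A₀) × (S × B₀)) ((R × A₀) × (S × B₀)) ℂ) :
    extend R S (∑ i, c i • F i) X = ∑ i, c i • extend R S (F i) X := by
  ext p q
  simp only [extend, Matrix.reindex_apply, Matrix.submatrix_apply, tensorMap_id_right_apply,
    LinearMap.sum_apply, LinearMap.smul_apply, Matrix.sum_apply, Matrix.smul_apply]

end Extension

/-! ### Compactness of convex hulls in finite dimension -/

section ConvexHull

/-- By Carathéodory, `finrank + 1` points suffice, so the hull is the continuous image of a simplex
times a power of `s`. -/
theorem isCompact_convexHull_of_isCompact {V : Type*} [AddCommGroup V] [Module ℝ V]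
    [TopologicalSpace V] [IsTopologicalAddGroup V] [ContinuousSMul ℝ V] [FiniteDimensional ℝ V]
    {s : Set V} (hs : IsCompact s) : IsCompact (convexHull ℝ s) := by
  rcases s.eq_empty_or_nonempty with rfl | ⟨v₀, hv₀⟩
  · simp
  let d := Module.finrank ℝ V + 1
  let f : (Fin d → ℝ) × (Fin d → V) → V := fun t => ∑ i, t.1 i • t.2 i
  have hf : Continuous f := by fun_prop
  have hK : IsCompact (stdSimplex ℝ (Fin d) ×ˢ (Set.univ.pi fun _ : Fin d => s)) :=
    (isCompact_stdSimplex ℝ (Fin d)).prod (isCompact_univ_pi fun _ => hs)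
  convert hK.image hf
  refine Set.Subset.antisymm (fun v hv => ?_) ?_
  · obtain ⟨ι, _, z, w, hz, hind, hw, hw1, rfl⟩ := eq_pos_convex_span_of_mem_convexHull hv
    have hcard : Fintype.card ι ≤ Fintype.card (Fin d) := by
      simpa [d] using hind.card_le_finrank_succ.trans
        (Nat.add_le_add_right (Submodule.finrank_le _) 1)
    obtain ⟨e⟩ := Function.Embedding.nonempty_of_card_le hcard
    -- Unused slots are padded with weight 0 and the arbitrary point `v₀` of `s`.
    refine ⟨(Function.extend e w 0, Function.extend e z fun _ => v₀), ⟨⟨fun i => ?_, ?_⟩, ?_⟩, ?_⟩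
    · by_cases hi : ∃ j, e j = i
      · obtain ⟨j, rfl⟩ := hi
        simpa [e.injective.extend_apply] using (hw j).le
      · simp [Function.extend_apply' _ _ _ hi]
    · rw [← hw1]
      refine (Finset.sum_subset (Finset.subset_univ (Finset.univ.map e)) ?_).symm.trans ?_
      · intro i _ hi
        simp only [Finset.mem_map, Finset.mem_univ, true_and] at hi
        simp [Function.extend_apply' _ _ _ hi]
      · simp [Finset.sum_map, e.injective.extend_apply]
    · intro i _
      by_cases hi : ∃ j, e j = i
      · obtain ⟨j, rfl⟩ := hi
        simpa [e.injective.extend_apply] using hz ⟨j, rfl⟩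
      · simpa [Function.extend_apply' _ _ _ hi] using hv₀
    · refine (Finset.sum_subset (Finset.subset_univ (Finset.univ.map e)) ?_).symm.trans ?_
      · intro i _ hi
        simp only [Finset.mem_map, Finset.mem_univ, true_and] at hi
        simp [Function.extend_apply' _ _ _ hi]
      · simp [Finset.sum_map, e.injective.extend_apply]
  · rintro _ ⟨t, ⟨ht, hs'⟩, rfl⟩
    exact mem_convexHull_of_exists_fintype t.1 t.2 ht.1 ht.2 (fun i => hs' i trivial) rfl

end ConvexHull

/-! ### Local correlations and the local bound -/

section LocalValues

variable {m n A₀ A₁ B₀ B₁ R S X Y α β : Type*}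

/-- The correlations `Tr(Mᵃ ρˣ) Tr(Nᵇ σʸ)` of a pair of local measurements. -/
noncomputable def localCorrelation [Fintype m] [Fintype n] (ρ : X → Matrix m m ℂ)
    (σ : Y → Matrix n n ℂ) (M : α → Matrix m m ℂ) (N : β → Matrix n n ℂ)
    (a : α) (b : β) (x : X) (y : Y) : ℝ :=
  ((M a * ρ x).trace).re * ((N b * σ y).trace).re

theorem continuous_localCorrelation [Fintype m] [Fintype n] (ρ : X → Matrix m m ℂ)
    (σ : Y → Matrix n n ℂ) (a : α) (b : β) (x : X) (y : Y) :
    Continuous fun t : (α → Matrix m m ℂ) × (β → Matrix n n ℂ) =>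
      localCorrelation ρ σ t.1 t.2 a b x y := by
  have hM : Continuous fun t : (α → Matrix m m ℂ) × (β → Matrix n n ℂ) => (t.1 a * ρ x).trace :=
    ((continuous_apply a).comp continuous_fst).matrix_mul continuous_const |>.matrix_trace
  have hN : Continuous fun t : (α → Matrix m m ℂ) × (β → Matrix n n ℂ) => (t.2 b * σ y).trace :=
    ((continuous_apply b).comp continuous_snd).matrix_mul continuous_const |>.matrix_trace
  exact (Complex.continuous_re.comp hM).mul (Complex.continuous_re.comp hN)

theorem behaviour_sum_tensorMap [Fintype A₀] [DecidableEq A₀] [Fintype A₁] [DecidableEq A₁]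
    [Fintype B₀] [DecidableEq B₀] [Fintype B₁] [Fintype R] [DecidableEq R] [Fintype S]
    [DecidableEq S] [Fintype α]
    {k : ℕ} {p : Fin k → ℝ}
    {EA : Fin k → (Matrix A₀ A₀ ℂ →ₗ[ℂ] Matrix A₁ A₁ ℂ)}
    {EB : Fin k → (Matrix B₀ B₀ ℂ →ₗ[ℂ] Matrix B₁ B₁ ℂ)}
    (hA : ∀ i, IsChannel (EA i))
    {ρ : X → Matrix (R × A₀) (R × A₀) ℂ} {σ : Y → Matrix (S × B₀) (S × B₀) ℂ}
    (hρ : ∀ x, IsState (ρ x))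
    {M : α → Matrix (R × A₁) (R × A₁) ℂ} {N : β → Matrix (S × B₁) (S × B₁) ℂ}
    (hM : IsPOVM M) (a : α) (b : β) (x : X) (y : Y) :
    behaviour (∑ i, (p i : ℂ) • tensorMap (EA i) (EB i)) ρ σ M N a b x y =
      ∑ i, p i * localCorrelation ρ σ
        (fun a => traceDual (tensorMap LinearMap.id (EA i)) (M a))
        (fun b => traceDual (tensorMap LinearMap.id (EB i)) (N b)) a b x y := by
  rw [behaviour, extend_sum_smul, Matrix.mul_sum, Matrix.trace_sum, Complex.re_sum]
  refine Finset.sum_congr rfl fun i _ => ?_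
  -- One real factor is enough for the real part of the product of traces to split.
  have hr := ofReal_re_of_nonneg
    (trace_mul_nonneg (hM.1 a) ((hA i).1.tensorMap_id_left (hρ x).1))
  rw [extend_tensorMap, Matrix.mul_smul, Matrix.trace_smul, ← Matrix.mul_kronecker_mul,
    Matrix.trace_kronecker, smul_eq_mul, Complex.re_ofReal_mul, localCorrelation,
    trace_traceDual_mul, trace_traceDual_mul, ← hr, Complex.re_ofReal_mul, Complex.ofReal_re]

variable [Fintype X] [Fintype Y] [Fintype α] [Fintype β]

theorem value_eq_sum_prod (γ p : α → β → X → Y → ℝ) :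
    value γ p = ∑ t : α × β × X × Y,
      γ t.1 t.2.1 t.2.2.1 t.2.2.2 * p t.1 t.2.1 t.2.2.1 t.2.2.2 := by
  simp only [value, Fintype.sum_prod_type]

theorem value_sum {ι : Type*} [Fintype ι] (γ : α → β → X → Y → ℝ) (c : ι → ℝ)
    (p : ι → α → β → X → Y → ℝ) :
    (value γ fun a b x y => ∑ i, c i * p i a b x y) = ∑ i, c i * value γ (p i) := by
  simp only [value_eq_sum_prod, Finset.mul_sum]
  rw [Finset.sum_comm]
  exact Finset.sum_congr rfl fun _ _ => Finset.sum_congr rfl fun _ _ => by ring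

theorem isGreatest_localMax [Fintype m] [DecidableEq m] [Fintype n] [DecidableEq n]
    [Nonempty α] [Nonempty β] (ρ : X → Matrix m m ℂ) (σ : Y → Matrix n n ℂ)
    (γ : α → β → X → Y → ℝ) : IsGreatest (localValues ρ σ γ) (localMax ρ σ γ) := by
  have h : localValues ρ σ γ = (fun t : (α → Matrix m m ℂ) × (β → Matrix n n ℂ) =>
      value γ (localCorrelation ρ σ t.1 t.2)) '' ({M | IsPOVM M} ×ˢ {N | IsPOVM N}) := by
    ext v
    constructor
    · rintro ⟨M, N, hM, hN, rfl⟩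
      exact ⟨(M, N), ⟨hM, hN⟩, rfl⟩
    · rintro ⟨⟨M, N⟩, ⟨hM, hN⟩, rfl⟩
      exact ⟨M, N, hM, hN, rfl⟩
  have hcont : Continuous fun t : (α → Matrix m m ℂ) × (β → Matrix n n ℂ) =>
      value γ (localCorrelation ρ σ t.1 t.2) := by
    unfold value
    refine continuous_finsetSum _ fun a _ => continuous_finsetSum _ fun b _ =>
      continuous_finsetSum _ fun x _ => continuous_finsetSum _ fun y _ => ?_
    exact continuous_const.mul (continuous_localCorrelation ρ σ a b x y)
  obtain ⟨M, hM⟩ := exists_isPOVM (n := m) (α := α)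
  obtain ⟨N, hN⟩ := exists_isPOVM (n := n) (α := β)
  rw [localMax, h]
  exact ((isCompact_isPOVM.prod isCompact_isPOVM).image hcont).isGreatest_sSup
    ⟨_, (M, N), ⟨hM, hN⟩, rfl⟩

/-- Correlations obeying every local bound are convex combinations of local correlations. -/
theorem exists_convex_localCorrelation [Fintype m] [DecidableEq m] [Fintype n] [DecidableEq n]
    [Nonempty α] [Nonempty β] (ρ : X → Matrix m m ℂ) (σ : Y → Matrix n n ℂ)
    (p : α → β → X → Y → ℝ) (hp : ∀ γ, value γ p ≤ localMax ρ σ γ) :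
    ∃ (k : ℕ) (w : Fin k → ℝ) (M : Fin k → α → Matrix m m ℂ) (N : Fin k → β → Matrix n n ℂ),
      (∀ i, 0 ≤ w i) ∧ ∑ i, w i = 1 ∧ (∀ i, IsPOVM (M i)) ∧ (∀ i, IsPOVM (N i)) ∧
      ∀ a b x y, p a b x y = ∑ i, w i * localCorrelation ρ σ (M i) (N i) a b x y := by
  classical
  let F : (α → Matrix m m ℂ) × (β → Matrix n n ℂ) → (α × β × X × Y → ℝ) := fun t s =>
    localCorrelation ρ σ t.1 t.2 s.1 s.2.1 s.2.2.1 s.2.2.2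
  have hF : Continuous F := continuous_pi fun s => continuous_localCorrelation ρ σ _ _ _ _
  let K := F '' ({M | IsPOVM M} ×ˢ {N | IsPOVM N})
  have hK : IsCompact (convexHull ℝ K) :=
    isCompact_convexHull_of_isCompact ((isCompact_isPOVM.prod isCompact_isPOVM).image hF)
  let q : α × β × X × Y → ℝ := fun s => p s.1 s.2.1 s.2.2.1 s.2.2.2
  have hq : q ∈ convexHull ℝ K := by
    by_contra hq
    obtain ⟨f, u, hu, hfq⟩ := geometric_hahn_banach_closed_point (convex_convexHull ℝ K)
      hK.isClosed hq
    -- The coefficients of the separating functional in the standard basis are the witness.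
    let γ : α → β → X → Y → ℝ := fun a b x y => f (Pi.single (a, b, x, y) 1)
    have hγ : ∀ r : α → β → X → Y → ℝ,
        f (fun s => r s.1 s.2.1 s.2.2.1 s.2.2.2) = value γ r := fun r => by
      rw [value_eq_sum_prod]
      refine (LinearMap.pi_apply_eq_sum_univ f.toLinearMap _).trans ?_
      refine Finset.sum_congr rfl fun s _ => ?_
      have hs : (fun j => if s = j then (1 : ℝ) else 0) = Pi.single s 1 := by
        ext j
        simp [Pi.single_apply, eq_comm]
      rw [smul_eq_mul, mul_comm, hs]
      rfl
    -- The local maximum is attained at a point of `K`, hence lies strictly below the separating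
    -- level `u`, while `p` lies above it.
    obtain ⟨M, N, hM, hN, hv⟩ := (isGreatest_localMax ρ σ γ).1
    have h1 := hu _ (subset_convexHull ℝ K ⟨(M, N), ⟨hM, hN⟩, rfl⟩)
    have h2 := hp γ
    rw [hv] at h2
    change f (fun s => localCorrelation ρ σ M N s.1 s.2.1 s.2.2.1 s.2.2.2) < u at h1
    rw [hγ] at h1
    change u < f (fun s => p s.1 s.2.1 s.2.2.1 s.2.2.2) at hfq
    rw [hγ] at hfq
    exact absurd h2 (not_le.2 (h1.trans hfq))
  obtain ⟨ι, _, w, z, hw0, hw1, hz, hwz⟩ := mem_convexHull_iff_exists_fintype.1 hq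
  choose t ht htz using hz
  let e := (Fintype.equivFin ι).symm
  refine ⟨Fintype.card ι, w ∘ e, fun i => (t (e i)).1, fun i => (t (e i)).2, fun i => hw0 _,
    by simpa using (e.sum_comp w).trans hw1, fun i => (ht (e i)).1, fun i => (ht (e i)).2,
    fun a b x y => ?_⟩
  have := congrFun hwz (a, b, x, y)
  rw [Finset.sum_apply] at this
  refine this.symm.trans ((e.sum_comp _).symm.trans (Finset.sum_congr rfl fun i _ => ?_))
  rw [Pi.smul_apply, smul_eq_mul, ← htz]
  rfl

/-- Channels implementable with local operations and shared randomness obey the local bounds,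
whatever measurements are performed. -/
theorem value_behaviour_le_localMax [Fintype A₀] [DecidableEq A₀] [Fintype A₁] [DecidableEq A₁]
    [Fintype B₀] [DecidableEq B₀] [Fintype B₁] [DecidableEq B₁] [Fintype R] [DecidableEq R] [Fintype S]
    [DecidableEq S]
    [Nonempty α] [Nonempty β]
    {ρ : X → Matrix (R × A₀) (R × A₀) ℂ} {σ : Y → Matrix (S × B₀) (S × B₀) ℂ}
    (hρ : ∀ x, IsState (ρ x)) (γ : α → β → X → Y → ℝ)
    {E : Matrix (A₀ × B₀) (A₀ × B₀) ℂ →ₗ[ℂ] Matrix (A₁ × B₁) (A₁ × B₁) ℂ}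
    {M : α → Matrix (R × A₁) (R × A₁) ℂ} {N : β → Matrix (S × B₁) (S × B₁) ℂ}
    (hE : IsLOSR E) (hM : IsPOVM M) (hN : IsPOVM N) :
    value γ (behaviour E ρ σ M N) ≤ localMax ρ σ γ := by
  obtain ⟨k, p, EA, EB, hp, hp1, hA, hB, rfl⟩ := hE
  have h : behaviour (∑ i, (p i : ℂ) • tensorMap (EA i) (EB i)) ρ σ M N = fun a b x y =>
      ∑ i, p i * localCorrelation ρ σ
        (fun a => traceDual (tensorMap LinearMap.id (EA i)) (M a))
        (fun b => traceDual (tensorMap LinearMap.id (EB i)) (N b)) a b x y := by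
    ext a b x y
    exact behaviour_sum_tensorMap hA hρ hM a b x y
  rw [h, value_sum]
  calc _ ≤ ∑ i, p i * localMax ρ σ γ := Finset.sum_le_sum fun i _ =>
        mul_le_mul_of_nonneg_left ((isGreatest_localMax ρ σ γ).2
          ⟨_, _, hM.pullback (hA i), hN.pullback (hB i), rfl⟩) (hp i)
    _ = localMax ρ σ γ := by rw [← Finset.sum_mul, hp1, one_mul]

end LocalValues

/-! ### Maximally entangled bases and channels recovered from measurements -/

section Bell

variable {R A A₀ α : Type*}

/-- The matrix `|w_l⟩⟨w_k|`, where `w_l(r) = v(r, l)`. -/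
def columnKetbra (v : EuclideanSpace ℂ (R × A)) (l k : A) : Matrix R R ℂ :=
  Matrix.vecMulVec (fun r => v (r, l)) (star fun r => v (r, k))

variable [Fintype R] [Fintype A] [Fintype α]

theorem card_eq_mul (ψ : OrthonormalBasis α ℂ (EuclideanSpace ℂ (R × A))) :
    Fintype.card α = Fintype.card R * Fintype.card A := by
  rw [← Module.finrank_eq_card_basis ψ.toBasis, finrank_euclideanSpace, Fintype.card_prod]

theorem nonempty_of_orthonormalBasis [Nonempty R] [Nonempty A]
    (ψ : OrthonormalBasis α ℂ (EuclideanSpace ℂ (R × A))) : Nonempty α := by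
  rw [← Fintype.card_pos_iff, card_eq_mul ψ]
  exact Nat.mul_pos Fintype.card_pos Fintype.card_pos

/-- The map recovered from a measurement `M` by averaging over the outcomes of a measurement in
the basis `ψ`. -/
noncomputable def recoveredMap [Fintype A₀] (ψ : OrthonormalBasis α ℂ (EuclideanSpace ℂ (R × A)))
    (M : α → Matrix (R × A₀) (R × A₀) ℂ) : Matrix A₀ A₀ ℂ →ₗ[ℂ] Matrix A A ℂ where
  toFun T := Matrix.of fun l k => ∑ a, (M a * (columnKetbra (ψ a) l k ⊗ₖ T)).trace
  map_add' T T' := by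
    ext l k
    simp [Matrix.kronecker_add, Matrix.mul_add, Finset.sum_add_distrib]
  map_smul' c T := by
    ext l k
    simp [Matrix.kronecker_smul, Finset.mul_sum]

theorem recoveredMap_apply [Fintype A₀]
    (ψ : OrthonormalBasis α ℂ (EuclideanSpace ℂ (R × A)))
    (M : α → Matrix (R × A₀) (R × A₀) ℂ) (T : Matrix A₀ A₀ ℂ) (l k : A) :
    recoveredMap ψ M T l k = ∑ a, (M a * (columnKetbra (ψ a) l k ⊗ₖ T)).trace := rfl

variable [DecidableEq R] [DecidableEq A]

variable {ψ : OrthonormalBasis α ℂ (EuclideanSpace ℂ (R × A))}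

theorem IsBellBasis.sum_fst (hψ : IsBellBasis ψ) (a : α) (i j : A) :
    ∑ r, ψ a (r, i) * star (ψ a (r, j)) = if i = j then 1 / (Fintype.card A : ℂ) else 0 := by
  have := congrFun (congrFun (hψ a).1 i) j
  simpa [traceFst, ketbra, Matrix.one_apply] using this

theorem IsBellBasis.sum_snd (hψ : IsBellBasis ψ) (a : α) (r s : R) :
    ∑ i, ψ a (r, i) * star (ψ a (s, i)) = if r = s then 1 / (Fintype.card R : ℂ) else 0 := by
  have := congrFun (congrFun (hψ a).2 r) s
  simpa [traceSnd, ketbra, Matrix.one_apply] using this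

theorem IsBellBasis.sum_columnKetbra (hψ : IsBellBasis ψ) (a : α) :
    ∑ l, columnKetbra (ψ a) l l = (1 / (Fintype.card R : ℂ)) • (1 : Matrix R R ℂ) := by
  ext r s
  have := hψ.sum_snd a r s
  simpa [columnKetbra, Matrix.sum_apply, Matrix.vecMulVec_apply, Matrix.one_apply] using this

/-- Teleportation in coordinates: contracting over `R` pairs columns of `ψ a`, which are orthogonal
with squared norm `1 / card A`. The two contractions select row `l` and column `k` of `Z`, each
contributing one factor `1 / card A`. -/
theorem IsBellBasis.trace_mul_columnKetbra (hψ : IsBellBasis ψ) (a : α) (l k : A)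
    (Z : Matrix A A ℂ) :
    (basisMeasurement ψ a * (columnKetbra (ψ a) l k ⊗ₖ Z)).trace =
      Z l k / (Fintype.card A : ℂ) ^ 2 := by
  have h1 : (basisMeasurement ψ a * (columnKetbra (ψ a) l k ⊗ₖ Z)).trace =
      ∑ i, ∑ j, (∑ r, ψ a (r, l) * star (ψ a (r, i))) *
        (∑ s, ψ a (s, j) * star (ψ a (s, k))) * Z i j := by
    calc _ = ∑ r, ∑ i, ∑ s, ∑ j, star (ψ a (r, i)) *
          (ψ a (r, l) * star (ψ a (s, k)) * Z i j * ψ a (s, j)) := by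
          rw [Matrix.trace_mul_comm, basisMeasurement, ketbra_eq_vecMulVec,
            trace_mul_vecMulVec_star]
          simp only [dotProduct, Matrix.mulVec, Fintype.sum_prod_type, Matrix.kroneckerMap_apply,
            columnKetbra, Matrix.vecMulVec_apply, Pi.star_apply, Finset.mul_sum]
      _ = _ := by
          rw [Finset.sum_comm]
          refine Finset.sum_congr rfl fun i _ => ?_
          rw [Finset.sum_congr rfl fun r _ => Finset.sum_comm, Finset.sum_comm]
          refine Finset.sum_congr rfl fun j _ => ?_
          rw [Finset.sum_mul_sum]
          simp only [Finset.sum_mul]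
          exact Finset.sum_congr rfl fun r _ => Finset.sum_congr rfl fun s _ => by ring
  rw [h1]
  simp only [hψ.sum_fst]
  rw [Finset.sum_eq_single l, Finset.sum_eq_single k]
  · simp
    ring
  · intro j _ hj
    simp [hj]
  · simp
  · intro i _ hi
    simp [hi.symm]
  · simp

/-- For the coefficient matrix `W` of a Bell vector, `W Wᴴ` and `Wᴴ W` are both scalar. Evaluating
`W Wᴴ W Wᴴ` with either one identifies the two scalars. -/
theorem IsBellBasis.card_eq [Nonempty R] [Nonempty A] (hψ : IsBellBasis ψ) :
    Fintype.card R = Fintype.card A := by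
  obtain ⟨a⟩ := nonempty_of_orthonormalBasis ψ
  have hR : (Fintype.card R : ℂ) ≠ 0 := by simp
  have hA : (Fintype.card A : ℂ) ≠ 0 := by simp
  let W : Matrix R A ℂ := Matrix.of fun r i => ψ a (r, i)
  have h1 : W * Wᴴ = (1 / (Fintype.card R : ℂ)) • (1 : Matrix R R ℂ) := by
    ext r s
    have := hψ.sum_snd a r s
    simpa [W, Matrix.mul_apply, Matrix.one_apply] using this
  have h2 : Wᴴ * W = (1 / (Fintype.card A : ℂ)) • (1 : Matrix A A ℂ) := by
    ext i j
    have := hψ.sum_fst a j i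
    simpa [W, Matrix.mul_apply, Matrix.one_apply, mul_comm, eq_comm] using this
  have h3 : (1 / (Fintype.card R : ℂ)) • (W * Wᴴ) = (1 / (Fintype.card A : ℂ)) • (W * Wᴴ) := by
    calc _ = (W * Wᴴ) * (W * Wᴴ) := by conv_rhs => rw [h1, Matrix.smul_mul, one_mul, ← h1]
      _ = W * (Wᴴ * W) * Wᴴ := by simp only [Matrix.mul_assoc]
      _ = _ := by rw [h2]; simp
  inhabit R
  have h4 := congrFun (congrFun h3 default) default
  rw [h1] at h4
  simp at h4
  exact_mod_cast h4

/-- Factoring `M a = Bᴴ B` exhibits Kraus operators. Trace preservation uses that each `ψ a` has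
maximally mixed marginal on `R`: summing over `l` replaces the ketbra by the same multiple of the
identity for all `a`, and then `∑ a, M a = 1` applies. -/
theorem isChannel_recoveredMap [Fintype A₀] [DecidableEq A₀] [Nonempty R] (hψ : IsBellBasis ψ)
    {M : α → Matrix (R × A₀) (R × A₀) ℂ} (hM : IsPOVM M) : IsChannel (recoveredMap ψ M) := by
  refine ⟨?_, fun T => ?_⟩
  · choose B hB using fun a => exists_conjTranspose_mul_self (hM.1 a)
    -- One Kraus operator for each outcome and each row of its factor `B`, that row being contracted
    -- with the Bell vector over `R`.
    let K : α × (R × A₀) → Matrix A A₀ ℂ := fun c =>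
      Matrix.of fun l i => ∑ r, B c.1 c.2 (r, i) * ψ c.1 (r, l)
    refine isCompletelyPositive_of_kraus K fun T => ?_
    ext l k
    rw [recoveredMap_apply, Matrix.sum_apply, Fintype.sum_prod_type]
    refine Finset.sum_congr rfl fun a _ => ?_
    rw [hB, Matrix.mul_assoc, Matrix.trace_mul_comm, Matrix.trace]
    refine Finset.sum_congr rfl fun c _ => ?_
    simp only [Matrix.diag_apply, Matrix.mul_apply, Matrix.conjTranspose_apply, K, Matrix.of_apply,
      star_sum, Fintype.sum_prod_type, Matrix.kroneckerMap_apply, columnKetbra,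
      Matrix.vecMulVec_apply, Pi.star_apply]
    rw [Finset.sum_comm]
    refine Finset.sum_congr rfl fun j _ => ?_
    rw [Finset.mul_sum]
    refine Finset.sum_congr rfl fun s _ => ?_
    simp only [Finset.sum_mul]
    rw [Finset.sum_comm]
    refine Finset.sum_congr rfl fun i _ => Finset.sum_congr rfl fun r _ => ?_
    rw [star_mul]
    ring
  · have hR : (Fintype.card R : ℂ) ≠ 0 := by simp
    have h : ∀ a, ∑ l, (M a * (columnKetbra (ψ a) l l ⊗ₖ T)).trace =
        (1 / (Fintype.card R : ℂ)) * (M a * ((1 : Matrix R R ℂ) ⊗ₖ T)).trace := fun a => by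
      rw [← Matrix.trace_sum, ← Matrix.mul_sum]
      have : ∑ l, columnKetbra (ψ a) l l ⊗ₖ T = (∑ l, columnKetbra (ψ a) l l) ⊗ₖ T := by
        ext p q
        simp [Matrix.sum_apply, Finset.sum_mul]
      rw [this, hψ.sum_columnKetbra, Matrix.smul_kronecker, Matrix.mul_smul, Matrix.trace_smul,
        smul_eq_mul]
    rw [Matrix.trace]
    simp only [Matrix.diag_apply, recoveredMap_apply]
    rw [Finset.sum_comm]
    simp only [h]
    rw [← Finset.mul_sum, ← Matrix.trace_sum, ← Finset.sum_mul, hM.2, one_mul,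
      Matrix.trace_kronecker, Matrix.trace_one]
    field_simp

end Bell

/-! ### Reconstructing an LOSR decomposition from correlations -/

section Recovery

variable {A₀ A₁ B₀ B₁ R S X Y α β : Type*}
    [Fintype A₀] [DecidableEq A₀] [Fintype A₁] [DecidableEq A₁]
    [Fintype B₀] [DecidableEq B₀] [Fintype B₁] [DecidableEq B₁]
    [Fintype R] [DecidableEq R] [Fintype S] [DecidableEq S] [Fintype α] [Fintype β]
    {ψ : OrthonormalBasis α ℂ (EuclideanSpace ℂ (R × A₁))}
    {φ : OrthonormalBasis β ℂ (EuclideanSpace ℂ (S × B₁))}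

/-- Bell measurements reveal the matrix entries of the output of a channel. -/
theorem trace_bell_mul_extend (hψ : IsBellBasis ψ) (hφ : IsBellBasis φ)
    (E : Matrix (A₀ × B₀) (A₀ × B₀) ℂ →ₗ[ℂ] Matrix (A₁ × B₁) (A₁ × B₁) ℂ)
    (T : Matrix A₀ A₀ ℂ) (Q : Matrix B₀ B₀ ℂ) (a : α) (b : β) (l k : A₁) (l' k' : B₁) :
    ((basisMeasurement ψ a ⊗ₖ basisMeasurement φ b) * extend R S E
      ((columnKetbra (ψ a) l k ⊗ₖ T) ⊗ₖ (columnKetbra (φ b) l' k' ⊗ₖ Q))).trace =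
      E (T ⊗ₖ Q) (l, l') (k, k') /
        ((Fintype.card A₁ : ℂ) ^ 2 * (Fintype.card B₁ : ℂ) ^ 2) := by
  rw [extend_kronecker]
  generalize E (T ⊗ₖ Q) = Z
  -- Both sides are linear in the output `Z`, so product outputs suffice; there the trace factors
  -- into one teleportation identity per party.
  let f : Matrix (A₁ × B₁) (A₁ × B₁) ℂ →ₗ[ℂ] ℂ :=
    { toFun := fun Z => ((basisMeasurement ψ a ⊗ₖ basisMeasurement φ b) *
        Matrix.reindex (shuffle R A₁ S B₁).symm (shuffle R A₁ S B₁).symm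
          (Z ⊗ₖ (columnKetbra (ψ a) l k ⊗ₖ columnKetbra (φ b) l' k'))).trace
      map_add' := fun Z Z' => by
        simp [Matrix.add_kronecker, Matrix.submatrix_add, Matrix.mul_add]
      map_smul' := fun c Z => by
        simp [Matrix.smul_kronecker, Matrix.submatrix_smul] }
  let g : Matrix (A₁ × B₁) (A₁ × B₁) ℂ →ₗ[ℂ] ℂ :=
    { toFun := fun Z => Z (l, l') (k, k') /
        ((Fintype.card A₁ : ℂ) ^ 2 * (Fintype.card B₁ : ℂ) ^ 2)
      map_add' := fun Z Z' => by simp [add_div]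
      map_smul' := fun c Z => by simp [mul_div_assoc] }
  have h : f = g := by
    refine linearMap_ext_kronecker fun Z Z' => ?_
    change ((basisMeasurement ψ a ⊗ₖ basisMeasurement φ b) *
      Matrix.reindex (shuffle R A₁ S B₁).symm (shuffle R A₁ S B₁).symm
        ((Z ⊗ₖ Z') ⊗ₖ (columnKetbra (ψ a) l k ⊗ₖ columnKetbra (φ b) l' k'))).trace =
      (Z ⊗ₖ Z') (l, l') (k, k') / ((Fintype.card A₁ : ℂ) ^ 2 * (Fintype.card B₁ : ℂ) ^ 2)
    rw [reindex_shuffle_kronecker, ← Matrix.mul_kronecker_mul, Matrix.trace_kronecker,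
      hψ.trace_mul_columnKetbra, hφ.trace_mul_columnKetbra, Matrix.kroneckerMap_apply,
      div_mul_div_comm]
  exact LinearMap.congr_fun h Z

/-- Identities between bilinear expressions extend from spanning families. -/
theorem trace_eq_of_span {ι : Type*} [Fintype ι]
    {ρ : X → Matrix (R × A₀) (R × A₀) ℂ} {σ : Y → Matrix (S × B₀) (S × B₀) ℂ}
    (hρ : Submodule.span ℂ (Set.range ρ) = ⊤) (hσ : Submodule.span ℂ (Set.range σ) = ⊤)
    (E : Matrix (A₀ × B₀) (A₀ × B₀) ℂ →ₗ[ℂ] Matrix (A₁ × B₁) (A₁ × B₁) ℂ)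
    (C : Matrix ((R × A₁) × (S × B₁)) ((R × A₁) × (S × B₁)) ℂ) (w : ι → ℂ)
    (M : ι → Matrix (R × A₀) (R × A₀) ℂ) (N : ι → Matrix (S × B₀) (S × B₀) ℂ)
    (h : ∀ x y, (C * extend R S E (ρ x ⊗ₖ σ y)).trace =
      ∑ i, w i * ((M i * ρ x).trace * (N i * σ y).trace))
    (P : Matrix (R × A₀) (R × A₀) ℂ) (Q : Matrix (S × B₀) (S × B₀) ℂ) :
    (C * extend R S E (P ⊗ₖ Q)).trace =
      ∑ i, w i * ((M i * P).trace * (N i * Q).trace) := by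
  let F : Matrix (R × A₀) (R × A₀) ℂ →ₗ[ℂ] Matrix (S × B₀) (S × B₀) ℂ →ₗ[ℂ] ℂ :=
    Matrix.kroneckerBilinear.compr₂
      (Matrix.traceLinearMap _ ℂ ℂ ∘ₗ LinearMap.mulLeft ℂ C ∘ₗ extendLin R S E)
  let G : Matrix (R × A₀) (R × A₀) ℂ →ₗ[ℂ] Matrix (S × B₀) (S × B₀) ℂ →ₗ[ℂ] ℂ :=
    ∑ i, w i • (LinearMap.mul ℂ ℂ).compl₁₂
      (Matrix.traceLinearMap _ ℂ ℂ ∘ₗ LinearMap.mulLeft ℂ (M i))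
      (Matrix.traceLinearMap _ ℂ ℂ ∘ₗ LinearMap.mulLeft ℂ (N i))
  have hG : ∀ P Q, G P Q = ∑ i, w i * ((M i * P).trace * (N i * Q).trace) := fun P Q => by
    simp [G, LinearMap.sum_apply]
  have hFG : F = G := by
    refine LinearMap.ext_on_range hρ fun x => LinearMap.ext_on_range hσ fun y => ?_
    rw [hG]
    exact h x y
  rw [← hG, ← hFG]
  rfl

/-- The index of the convex decomposition serves as the shared randomness: the weights are kept, and
each pair of measurements becomes a pair of recovered channels. -/
theorem isLOSR_of_value_le_localMax [Fintype X] [Fintype Y] [Nonempty A₁] [Nonempty B₁]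
    [Nonempty R] [Nonempty S]
    {ρ : X → Matrix (R × A₀) (R × A₀) ℂ} {σ : Y → Matrix (S × B₀) (S × B₀) ℂ}
    (hρ : ∀ x, IsState (ρ x)) (hσ : ∀ y, IsState (σ y))
    (hρ_span : Submodule.span ℂ (Set.range ρ) = ⊤)
    (hσ_span : Submodule.span ℂ (Set.range σ) = ⊤)
    (hψ : IsBellBasis ψ) (hφ : IsBellBasis φ)
    {E : Matrix (A₀ × B₀) (A₀ × B₀) ℂ →ₗ[ℂ] Matrix (A₁ × B₁) (A₁ × B₁) ℂ} (hE : IsChannel E)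
    (h : ∀ γ, value γ (behaviour E ρ σ (basisMeasurement ψ) (basisMeasurement φ)) ≤
      localMax ρ σ γ) : IsLOSR E := by
  have := nonempty_of_orthonormalBasis ψ
  have := nonempty_of_orthonormalBasis φ
  obtain ⟨k, w, M, N, hw, hw1, hM, hN, hp⟩ := exists_convex_localCorrelation ρ σ _ h
  refine ⟨k, w, fun i => recoveredMap ψ (M i), fun i => recoveredMap φ (N i), hw, hw1,
    fun i => isChannel_recoveredMap hψ (hM i), fun i => isChannel_recoveredMap hφ (hN i), ?_⟩
  -- `behaviour` records only real parts. All the traces involved are nonnegative, so the identity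
  -- lifts to `ℂ`, where it can be extended linearly.
  have hstates : ∀ a b x y, ((basisMeasurement ψ a ⊗ₖ basisMeasurement φ b) *
      extend R S E (ρ x ⊗ₖ σ y)).trace =
        ∑ i, (w i : ℂ) * ((M i a * ρ x).trace * (N i b * σ y).trace) := fun a b x y => by
    rw [← ofReal_re_of_nonneg (trace_mul_nonneg
      (((isPOVM_basisMeasurement ψ).1 a).kronecker ((isPOVM_basisMeasurement φ).1 b))
      (extend_posSemidef hE.1 ((hρ x).1.kronecker (hσ y).1)))]
    refine (congrArg _ (hp a b x y)).trans ?_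
    push_cast [localCorrelation]
    refine Finset.sum_congr rfl fun i _ => ?_
    rw [ofReal_re_of_nonneg (trace_mul_nonneg ((hM i).1 a) (hρ x).1),
      ofReal_re_of_nonneg (trace_mul_nonneg ((hN i).1 b) (hσ y).1)]
  refine linearMap_ext_kronecker fun T Q => ?_
  ext ⟨l, l'⟩ ⟨m, m'⟩
  have hA : (Fintype.card A₁ : ℂ) ≠ 0 := by simp
  have hB : (Fintype.card B₁ : ℂ) ≠ 0 := by simp
  -- The extended identity is evaluated at the teleportation inputs, which depend on the outcomes
  -- `a`, `b` and are not states in general.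
  have hab : ∀ a b, E (T ⊗ₖ Q) (l, l') (m, m') /
      ((Fintype.card A₁ : ℂ) ^ 2 * (Fintype.card B₁ : ℂ) ^ 2) =
      ∑ i, (w i : ℂ) * ((M i a * (columnKetbra (ψ a) l m ⊗ₖ T)).trace *
        (N i b * (columnKetbra (φ b) l' m' ⊗ₖ Q)).trace) := fun a b => by
    rw [← trace_bell_mul_extend hψ hφ E T Q a b]
    exact trace_eq_of_span hρ_span hσ_span E _ _ _ _ (hstates a b) _ _
  have hcα : (Fintype.card α : ℂ) = (Fintype.card A₁ : ℂ) ^ 2 := by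
    rw [card_eq_mul ψ, hψ.card_eq]
    push_cast
    ring
  have hcβ : (Fintype.card β : ℂ) = (Fintype.card B₁ : ℂ) ^ 2 := by
    rw [card_eq_mul φ, hφ.card_eq]
    push_cast
    ring
  -- Every outcome pair yields the same entry, and the number of pairs is exactly the normalizing
  -- denominator. Summing over `a` and `b` separately then forms the two recovered maps.
  calc E (T ⊗ₖ Q) (l, l') (m, m') = ∑ _a : α, ∑ _b : β, E (T ⊗ₖ Q) (l, l') (m, m') /
      ((Fintype.card A₁ : ℂ) ^ 2 * (Fintype.card B₁ : ℂ) ^ 2) := by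
        simp only [Finset.sum_const, Finset.card_univ, nsmul_eq_mul, hcα, hcβ]
        field_simp
    _ = ∑ a, ∑ b, ∑ i, (w i : ℂ) * ((M i a * (columnKetbra (ψ a) l m ⊗ₖ T)).trace *
        (N i b * (columnKetbra (φ b) l' m' ⊗ₖ Q)).trace) :=
        Finset.sum_congr rfl fun a _ => Finset.sum_congr rfl fun b _ => hab a b
    _ = ∑ i, (w i : ℂ) * (recoveredMap ψ (M i) T l m * recoveredMap φ (N i) Q l' m') := by
        rw [Finset.sum_congr rfl fun a _ => Finset.sum_comm, Finset.sum_comm]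
        refine Finset.sum_congr rfl fun i _ => ?_
        rw [recoveredMap_apply, recoveredMap_apply, Finset.sum_mul_sum]
        simp only [Finset.mul_sum]
    _ = _ := by
        simp only [LinearMap.sum_apply, LinearMap.smul_apply, tensorMap_kronecker,
          Matrix.sum_apply, Matrix.smul_apply, Matrix.kroneckerMap_apply, smul_eq_mul]

end Recovery

end LOSRWitness

theorem mainTheorem4 {A₀ A₁ B₀ B₁ R S X Y α β : Type*}
    [Fintype A₀] [DecidableEq A₀] [Nonempty A₀] [Fintype A₁] [DecidableEq A₁] [Nonempty A₁]
    [Fintype B₀] [DecidableEq B₀] [Nonempty B₀] [Fintype B₁] [DecidableEq B₁] [Nonempty B₁]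
    [Fintype R] [DecidableEq R] [Nonempty R] [Fintype S] [DecidableEq S] [Nonempty S]
    [Fintype X] [Fintype Y] [Fintype α] [Fintype β]
    (ρ : X → Matrix (R × A₀) (R × A₀) ℂ) (σ : Y → Matrix (S × B₀) (S × B₀) ℂ)
    (hρ : ∀ x, LOSRWitness.IsState (ρ x)) (hσ : ∀ y, LOSRWitness.IsState (σ y))
    (hρ_indep : LinearIndependent ℂ ρ) (hσ_indep : LinearIndependent ℂ σ)
    (hρ_span : Submodule.span ℂ (Set.range ρ) = ⊤)
    (hσ_span : Submodule.span ℂ (Set.range σ) = ⊤)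
    (ψ : OrthonormalBasis α ℂ (EuclideanSpace ℂ (R × A₁)))
    (φ : OrthonormalBasis β ℂ (EuclideanSpace ℂ (S × B₁)))
    (hψ : LOSRWitness.IsBellBasis ψ) (hφ : LOSRWitness.IsBellBasis φ) :
    -- the maximum over local measurements exists, for every functional
    (∀ γ : α → β → X → Y → ℝ,
      IsGreatest (LOSRWitness.localValues ρ σ γ) (LOSRWitness.localMax ρ σ γ)) ∧
    -- the characterization of non-LOSR channels
    (∀ E : Matrix (A₀ × B₀) (A₀ × B₀) ℂ →ₗ[ℂ] Matrix (A₁ × B₁) (A₁ × B₁) ℂ,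
      LOSRWitness.IsChannel E →
      (¬ LOSRWitness.IsLOSR E ↔
        ∃ γ : α → β → X → Y → ℝ,
          LOSRWitness.value γ (LOSRWitness.behaviour E ρ σ
            (LOSRWitness.basisMeasurement ψ) (LOSRWitness.basisMeasurement φ)) >
          LOSRWitness.localMax ρ σ γ)) ∧
    -- the bound holds for every LOSR channel whatever (untrusted) measurements are performed
    (∀ (γ : α → β → X → Y → ℝ)
      (E : Matrix (A₀ × B₀) (A₀ × B₀) ℂ →ₗ[ℂ] Matrix (A₁ × B₁) (A₁ × B₁) ℂ)
      (M : α → Matrix (R × A₁) (R × A₁) ℂ) (N : β → Matrix (S × B₁) (S × B₁) ℂ),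
      LOSRWitness.IsLOSR E → LOSRWitness.IsPOVM M → LOSRWitness.IsPOVM N →
        LOSRWitness.value γ (LOSRWitness.behaviour E ρ σ M N) ≤
          LOSRWitness.localMax ρ σ γ) := by
  have := LOSRWitness.nonempty_of_orthonormalBasis ψ
  have := LOSRWitness.nonempty_of_orthonormalBasis φ
  refine ⟨LOSRWitness.isGreatest_localMax ρ σ, fun E hE => ⟨fun hn => ?_, ?_⟩,
    fun γ E M N hE hM hN => LOSRWitness.value_behaviour_le_localMax hρ γ hE hM hN⟩
  · by_contra! h
    exact hn (LOSRWitness.isLOSR_of_value_le_localMax hρ hσ hρ_span hσ_span hψ hφ hE h)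
  · rintro ⟨γ, hγ⟩ hL
    exact hγ.not_ge (LOSRWitness.value_behaviour_le_localMax hρ γ hL
      (LOSRWitness.isPOVM_basisMeasurement ψ) (LOSRWitness.isPOVM_basisMeasurement φ))
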